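/- **Theorem 3.3 (analytic spread of squarefree Borel ideals).** Let $K$ be a field and $S=K[x_1,\dots,x_N]$ with $\mathfrak m=(x_1,\dots,x_N)$. A *squarefree Borel ideal* is an ideal $I\subseteq S$ generated by squarefree monomials such that for every squarefree monomial $u\in I$, every $x_j$ dividing $u$ and every $i<j$, the monomial $x_i(u/x_j)$ lies in $I$ whenever it is squarefree. For squarefree monomials $u_1,\dots,u_m$, the squarefree Borel ideal *with Borel generators* $u_1,\dots,u_m$ is the smallest squarefree Borel ideal containing them (the intersection of all such ideals). A monomial ideal is *equigenerated* if all elements of its minimal set $G(I)$ of monomial generators have the same degree. The *first block* of a squarefree monomial $u\neq 1$ is the largest set of consecutive integers that contains $\min(\operatorname{supp}(u))$ and is contained in $\operatorname{supp}(u)=\{i : x_i\mid u\}$; and $\max(u)$ is the largest element of $\operatorname{supp}(u)$. The *analytic spread* $\ell(I)$ is the Krull dimension of $\mathcal R(I)/\mathfrak m\mathcal R(I)$, where $\mathcal R(I)=\bigoplus_{k\ge 0}I^kt^k$ is the Rees algebra of $I$. Let $I\subset S$ be an equigenerated squarefree Borel ideal, not a principal ideal, with Borel generators $u_1,\dots,u_m\in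 G(I)$. Let $B_{i1}$ be the first block of $u_i$ and $n=\max\{\max(u_i): 1\le i\le m\}$. Then $$\ell(I)=\begin{cases} n & \text{if } 1\notin\bigcap_{i=1}^m B_{i1},\\ n-\bigl|\bigcap_{i=1}^m B_{i1}\bigr| & \text{otherwise.}\end{cases}$$ -/

import Mathlib

namespace BorelIdeals

open MvPolynomial

/-! Monomials of `S = K[x_1, …, x_N] = MvPolynomial (Fin N) K` are given by their exponent vectors
`a : Fin N →₀ ℕ`. The variable `X i`, for `i : Fin N`, is the variable `x_{i+1}`.
On exponent vectors `≤` is divisibility and `Finsupp.degree` is the degree of the monomial. -/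

/-- The monomial `a` is `k`-bounded: `a_i ≤ k` for all `i`. For `k = 1` these are the squarefree
monomials. -/
def IsKBounded {N : ℕ} (k : ℕ) (a : Fin N →₀ ℕ) : Prop :=
  ∀ i, a i ≤ k

/-- `I` is a monomial ideal that is generated by `k`-bounded monomials. -/
def IsKBoundedIdeal {N : ℕ} {K : Type*} [Field K] (k : ℕ) (I : Ideal (MvPolynomial (Fin N) K)) :
    Prop :=
  ∃ A : Set (Fin N →₀ ℕ), (∀ a ∈ A, IsKBounded k a) ∧
    I = Ideal.span ((fun a => (monomial a (1 : K))) '' A)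

/-- `I` is a `k`-Borel ideal: it is generated by `k`-bounded monomials, and for every `k`-bounded
monomial `a ∈ I`, every `j ∈ supp(a)` and every `i < j`, the monomial `x_i (a / x_j)` is in `I`
provided that it is `k`-bounded. -/
def IsKBorel {N : ℕ} {K : Type*} [Field K] (k : ℕ) (I : Ideal (MvPolynomial (Fin N) K)) : Prop :=
  IsKBoundedIdeal k I ∧
    ∀ a : Fin N →₀ ℕ, IsKBounded k a → monomial a (1 : K) ∈ I →
      ∀ i j : Fin N, j ∈ a.support → i < j →
        IsKBounded k (a - Finsupp.single j 1 + Finsupp.single i 1) →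
          monomial (a - Finsupp.single j 1 + Finsupp.single i 1) (1 : K) ∈ I

/-- `B_k(u_1, …, u_m)`, the intersection of all `k`-Borel ideals that contain the monomials
`u_1, …, u_m`. A squarefree Borel ideal with Borel generators `u_1, …, u_m` is
`B_1(u_1, …, u_m)`. -/
noncomputable def borelIdeal {N m : ℕ} (K : Type*) [Field K] (k : ℕ) (u : Fin m → Fin N →₀ ℕ) :
    Ideal (MvPolynomial (Fin N) K) :=
  sInf {J | IsKBorel k J ∧ ∀ i, monomial (u i) (1 : K) ∈ J}

/-- `G(I)`: the monomials in `I` that are minimal with respect to divisibility. For a monomial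
ideal this is its unique minimal set of monomial generators. -/
def minGens {N : ℕ} {K : Type*} [Field K] (I : Ideal (MvPolynomial (Fin N) K)) :
    Set (Fin N →₀ ℕ) :=
  {a | Minimal (fun b => monomial b (1 : K) ∈ I) a}

/-- `I` is equigenerated: all elements of `G(I)` have the same degree. -/
def IsEquigenerated {N : ℕ} {K : Type*} [Field K] (I : Ideal (MvPolynomial (Fin N) K)) : Prop :=
  ∃ d : ℕ, ∀ a ∈ minGens I, a.degree = d

/-- `supp(a) = {i : x_i ∣ a} ⊆ {1, …, N}`, with variables numbered from `1`. -/
def supp {N : ℕ} (a : Fin N →₀ ℕ) : Finset ℕ :=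
  a.support.image (fun i : Fin N => (i : ℕ) + 1)

/-- `max(a)`, the largest element of `supp(a)` (for `a ≠ 1`). -/
def maxSupp {N : ℕ} (a : Fin N →₀ ℕ) : ℕ :=
  (supp a).sup id

/-- `B` is a block of `a`: a nonempty set of consecutive integers contained in `supp(a)`. -/
def IsBlock {N : ℕ} (a : Fin N →₀ ℕ) (B : Finset ℕ) : Prop :=
  (∃ p q : ℕ, p ≤ q ∧ B = Finset.Icc p q) ∧ B ⊆ supp a

/-- `B` is the first block in the block decomposition of `supp(a)` into maximal blocks: the
maximal block that contains the smallest element of `supp(a)`. -/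
def IsFirstBlock {N : ℕ} (a : Fin N →₀ ℕ) (B : Finset ℕ) : Prop :=
  Maximal (IsBlock a) B ∧ ∃ i ∈ B, ∀ j ∈ supp a, i ≤ j

/-- The analytic spread `ℓ(I)`: the Krull dimension of the fiber ring `R(I) / 𝔪 R(I)`, where
`R(I)` is the Rees algebra of `I` and `𝔪 = (x_1, …, x_N)`. -/
noncomputable def analyticSpread {N : ℕ} {K : Type*} [Field K]
    (I : Ideal (MvPolynomial (Fin N) K)) : WithBot ℕ∞ :=
  ringKrullDim (reesAlgebra I ⧸
    (Ideal.span (Set.range (X : Fin N → MvPolynomial (Fin N) K))).map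
      (algebraMap (MvPolynomial (Fin N) K) (reesAlgebra I)))

end BorelIdeals

/-! When `I` is generated by a set `G` of monomials of one degree `d > 0`, the fiber ring is the
toric ring `K[x^a : a ∈ G]`, and the dimension of that ring is the rank over `ℚ` of the exponent
vectors (`analyticSpread_eq_ringKrullDim_adjoin`, `ringKrullDim_adjoin_monomial`). It remains to
compute a rank (`finrank_span_exponents`).

Let `r` be maximal such that `x_1, …, x_r` divide every `u_i`. Then they divide every generator of
`I`, and no variable beyond `x_n` occurs. On the span of the exponents each of the first `r`
coordinates is `1/d` times the coordinate sum, so coordinates `r + 1, …, n` determine a vector and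
the rank is at most `n - r`. This uses `r < d`, which holds because `I` is not principal.
Conversely, Borel exchanges put every difference `e_{r+1} - e_j` with `r + 1 < j ≤ n` in the span,
and one more generator gives full rank.

If some first block misses 1, then `r = 0`; otherwise the first blocks are intervals starting at 1
and `r` is the length of the shortest. -/

/-! ### Krull dimension and transcendence degree. -/

section IntegralDimension

open MvPolynomial

variable {R A : Type*} [CommRing R] [CommRing A] [Algebra R A]

/-- Incomparability gives `≤`; lying over and going up lift chains and give `≥`. -/
theorem ringKrullDim_eq_of_isIntegral_of_injective [IsDomain A] [Algebra.IsIntegral R A]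
    (hinj : Function.Injective (algebraMap R A)) : ringKrullDim A = ringKrullDim R := by
  apply le_antisymm
  · exact Order.krullDim_le_of_strictMono (PrimeSpectrum.comap (algebraMap R A))
      fun P Q h => Ideal.IsIntegral.comap_lt_comap (R := R) h
  · refine iSup_le fun l => ?_
    obtain ⟨P, hP, hPl⟩ := Ideal.exists_ideal_over_prime_of_isIntegral_of_isDomain (S := A)
      l.head.asIdeal (by rw [(RingHom.injective_iff_ker_eq_bot _).mp hinj]; exact bot_le)
    have : P.LiesOver l.head.asIdeal := ⟨hPl.symm⟩
    obtain ⟨L, hL, -, -⟩ := Ideal.exists_ltSeries_of_hasGoingUp l P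
    rw [← hL]
    exact le_iSup (fun l : LTSeries (PrimeSpectrum A) => (l.length : WithBot ℕ∞)) L

/-- By Noether normalization `A` is integral over a polynomial ring, whose variables form another
transcendence basis of `A`, of the same cardinality. -/
theorem ringKrullDim_eq_card_of_isTranscendenceBasis {K A ι : Type*} [Field K] [CommRing A]
    [IsDomain A] [Algebra K A] [Algebra.FiniteType K A] {x : ι → A}
    (hx : IsTranscendenceBasis K x) : ringKrullDim A = (Nat.card ι : WithBot ℕ∞) := by
  obtain ⟨s, g, hginj, hgint⟩ := exists_integral_inj_algHom_of_fg K A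
  algebraize [g.toRingHom]
  have hdim : ringKrullDim A = ringKrullDim (MvPolynomial (Fin s) K) :=
    ringKrullDim_eq_of_isIntegral_of_injective hginj
  have hg : IsTranscendenceBasis K fun i => g (X i) := by
    have : FaithfulSMul (MvPolynomial (Fin s) K) A :=
      (faithfulSMul_iff_algebraMap_injective _ _).mpr hginj
    have := (IsTranscendenceBasis.mvPolynomial (Fin s) K)
    have := this.algebraMap_comp (A := A)
    exact this
  have hcard : Nat.card ι = s := by
    have := hx.lift_cardinalMk_eq hg
    have := congrArg Cardinal.toNat this
    simpa [Nat.card] using this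
  rw [hdim, MvPolynomial.ringKrullDim_of_isNoetherianRing, ringKrullDim_eq_zero_of_field, hcard]
  simp

end IntegralDimension

/-! ### Dimension of algebras generated by monomials. -/

section MonomialAlgebra

open MvPolynomial

variable {K σ : Type*} [Field K]

/-- The substitution sends the monomial with exponent `c` to the one with exponent `∑ c_i a_i`. It
is therefore injective exactly when `c ↦ ∑ c_i a_i` is, which is what linear independence over `ℕ`
means. -/
theorem algebraicIndependent_monomial_iff {ι : Type*} (a : ι → σ →₀ ℕ) :
    AlgebraicIndependent K (fun i => monomial (a i) (1 : K)) ↔ LinearIndependent ℕ a := by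
  classical
  have h : ∀ c : ι →₀ ℕ, ∀ r : K, aeval (fun i => monomial (a i) (1 : K)) (monomial c r) =
      monomial (Finsupp.linearCombination ℕ a c) r := by
    intro c r
    rw [aeval_monomial, Finsupp.prod, Finsupp.linearCombination_apply, Finsupp.sum]
    simp only [monomial_pow, one_pow, ← monomial_sum_one, algebraMap_eq, C_mul_monomial, mul_one]
  constructor
  · intro hK c c' hcc
    have := hK (a₁ := monomial c 1) (a₂ := monomial c' 1) (by simp only [h, hcc])
    exact (monomial_left_inj one_ne_zero).mp this
  · intro ha
    rw [AlgebraicIndependent, injective_iff_map_eq_zero]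
    intro p hp
    ext c
    have hc := congrArg (coeff (Finsupp.linearCombination ℕ a c)) hp
    rw [p.as_sum, map_sum, coeff_sum, Finset.sum_eq_single c] at hc
    · rwa [h, coeff_monomial, if_pos rfl, coeff_zero] at hc
    · intro c' _ hc'
      rw [h, coeff_monomial, if_neg fun he => hc' (ha he)]
    · intro hc'
      rw [notMem_support_iff.mp hc', monomial_zero, map_zero, coeff_zero]

/-- The inclusion of exponent vectors into rational vectors. -/
noncomputable def exponentCast (σ : Type*) : (σ →₀ ℕ) →ₗ[ℕ] (σ → ℚ) where
  toFun a j := a j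
  map_add' a b := by ext; simp
  map_smul' c a := by ext; simp

@[simp] theorem exponentCast_apply (a : σ →₀ ℕ) (j : σ) : exponentCast σ a j = a j := rfl

theorem exponentCast_injective : Function.Injective (exponentCast σ) := fun a b h => by
  ext j
  simpa using congrFun h j

theorem linearIndependent_exponentCast_iff {ι : Type*} (a : ι → σ →₀ ℕ) :
    LinearIndependent ℚ (exponentCast σ ∘ a) ↔ LinearIndependent ℕ a := by
  constructor
  · intro h
    exact LinearIndependent.of_comp (exponentCast σ)
      (h.restrict_scalars (by intro x y hxy; simpa using hxy))
  · intro h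
    rw [← LinearIndependent.iff_fractionRing ℤ ℚ, linearIndependent_iff']
    intro s g hg i hi
    rw [linearIndependent_iff'ₛ] at h
    -- Splitting integer coefficients into positive and negative parts turns a relation over `ℤ`
    -- into an equality of two combinations over `ℕ`.
    have := h s (fun j => (g j).toNat) (fun j => (-g j).toNat) ?_ i hi
    · omega
    · apply exponentCast_injective
      simp only [map_sum, map_nsmul]
      rw [← sub_eq_zero, ← Finset.sum_sub_distrib, ← hg]
      refine Finset.sum_congr rfl fun j _ => ?_
      conv_rhs => rw [← (g j).toNat_sub_toNat_neg]
      simp only [sub_smul, natCast_zsmul, Function.comp_apply]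

/-- A transcendence basis can be chosen among the generators, and its exponents are independent;
conversely, a basis of the span chosen among the exponents gives algebraically independent
monomials. -/
theorem ringKrullDim_adjoin_monomial [Finite σ] {G : Set (σ →₀ ℕ)} (hG : G.Finite) :
    ringKrullDim (Algebra.adjoin K ((fun a => monomial a (1 : K)) '' G)) =
      (Module.finrank ℚ (Submodule.span ℚ (exponentCast σ '' G)) : WithBot ℕ∞) := by
  set A := Algebra.adjoin K ((fun a => monomial a (1 : K)) '' G) with hA
  have : Algebra.FiniteType K A :=
    A.fg_iff_finiteType.mp ⟨(hG.image (fun a => monomial a (1 : K))).toFinset, by simp [hA]⟩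
  let s : Set A := Subtype.val ⁻¹' ((fun a => monomial a (1 : K)) '' G)
  have hs : Algebra.adjoin K s = ⊤ := Algebra.adjoin_adjoin_coe_preimage
  have : Algebra.IsAlgebraic (Algebra.adjoin K s) A := by
    rw [hs]
    exact ⟨fun x => isAlgebraic_algebraMap (⟨x, trivial⟩ : (⊤ : Subalgebra K A))⟩
  obtain ⟨t, hts, ht⟩ := exists_isTranscendenceBasis_subset (R := K) s
  rw [ringKrullDim_eq_card_of_isTranscendenceBasis ht]
  have htfin : Finite t := ((hG.image _).preimage Subtype.val_injective.injOn).subset hts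
  choose e heG he using fun x : t => hts x.2
  congr 1
  apply le_antisymm
  · have h1 : AlgebraicIndependent K (fun x : t => monomial (e x) (1 : K)) := by
      have := ht.1.map' (f := A.val) Subtype.val_injective
      convert this using 1
      exact funext he
    rw [algebraicIndependent_monomial_iff, ← linearIndependent_exponentCast_iff] at h1
    have := Fintype.ofFinite t
    rw [Nat.card_eq_fintype_card, ← finrank_span_eq_card h1]
    refine Submodule.finrank_mono (Submodule.span_mono ?_)
    rintro _ ⟨x, rfl⟩
    exact ⟨e x, heG x, rfl⟩
  · obtain ⟨b, hbG, hbs, hb⟩ := exists_linearIndependent ℚ (exponentCast σ '' G)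
    have := ((hG.image _).subset hbG).fintype
    rw [← hbs, ← Set.coe_toFinset b, finrank_span_finset_eq_card (by rwa [Set.coe_toFinset]),
      Set.toFinset_card]
    choose g hgG hg using fun y : b => hbG y.2
    have h1 : LinearIndependent ℚ (exponentCast σ ∘ g) := by
      rwa [show exponentCast σ ∘ g = Subtype.val from funext hg]
    rw [linearIndependent_exponentCast_iff, ← algebraicIndependent_monomial_iff (K := K)] at h1
    let x : b → A := fun y => ⟨monomial (g y) 1, Algebra.subset_adjoin ⟨g y, hgG y, rfl⟩⟩
    have hx : AlgebraicIndependent K x :=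
      (A.val.algebraicIndependent_iff Subtype.val_injective).mp h1
    have h2 := hx.lift_cardinalMk_le_trdeg
    rw [← ht.cardinalMk_eq_trdeg] at h2
    have := Cardinal.toNat_le_toNat h2 (by simp)
    simpa [Nat.card] using this

end MonomialAlgebra

/-! ### The fiber ring as a toric ring. -/

section FiberRing

open MvPolynomial

variable {K : Type*} [Field K] {N : ℕ} {I : Ideal (MvPolynomial (Fin N) K)}
  {G : Set (Fin N →₀ ℕ)} {d : ℕ}

theorem monomial_mem_of_eq_span (hI : I = Ideal.span ((fun a => monomial a (1 : K)) '' G)) (a : G) :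
    monomial a.1 (1 : K) ∈ I :=
  hI ▸ Ideal.subset_span ⟨a.1, a.2, rfl⟩

/-- The presentation of the fiber ring: the variable indexed by `a` goes to the degree one element
`x^a t` of the Rees algebra. -/
noncomputable def reesPresentation
    (hI : I = Ideal.span ((fun a => monomial a (1 : K)) '' G)) :
    MvPolynomial G K →ₐ[K] reesAlgebra I :=
  aeval fun a => ⟨Polynomial.monomial 1 (monomial a.1 1),
    reesAlgebra.monomial_mem.mpr (by simpa using monomial_mem_of_eq_span hI a)⟩

theorem reesPresentation_coe (hI : I = Ideal.span ((fun a => monomial a (1 : K)) '' G))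
    (p : MvPolynomial G K) : (reesPresentation hI p : Polynomial (MvPolynomial (Fin N) K)) =
      aeval (fun a : G => Polynomial.monomial 1 (monomial a.1 (1 : K))) p := by
  rw [reesPresentation]
  exact comp_aeval_apply _ ((reesAlgebra I).val.restrictScalars K) p

theorem isHomogeneous_coeff_reesPresentation
    (hI : I = Ideal.span ((fun a => monomial a (1 : K)) '' G)) (hd : ∀ a ∈ G, a.degree = d)
    (p : MvPolynomial G K) (k : ℕ) :
    ((reesPresentation hI p).1.coeff k).IsHomogeneous (d * k) := by
  rw [reesPresentation_coe]
  induction p using MvPolynomial.induction_on generalizing k with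
  | C r =>
    rw [algHom_C, IsScalarTower.algebraMap_apply K (MvPolynomial (Fin N) K),
      Polynomial.algebraMap_apply, Polynomial.coeff_C]
    split_ifs with hk
    · subst hk
      exact isHomogeneous_C _ _
    · exact isHomogeneous_zero _ _ _
  | add p q hp hq =>
    rw [map_add, Polynomial.coeff_add]
    exact (hp k).add (hq k)
  | mul_X p a hp =>
    rw [map_mul, aeval_X]
    cases k with
    | zero =>
      rw [Polynomial.mul_coeff_zero, Polynomial.coeff_monomial, if_neg one_ne_zero, mul_zero]
      exact isHomogeneous_zero _ _ _
    | succ k =>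
      rw [Polynomial.coeff_mul_monomial]
      exact (hp k).mul (isHomogeneous_monomial _ (hd a.1 a.2))

/-- Setting `t = 1` gives one direction. For the other, `τ : x_i ↦ x_i t` sends `x^a` to `x^a t^d`
for `a ∈ G`, so `τ` of the toric value is the Rees value after `t ↦ t^d`, a substitution that is
injective since `d > 0`. -/
theorem reesPresentation_eq_zero_iff (hI : I = Ideal.span ((fun a => monomial a (1 : K)) '' G))
    (hd : ∀ a ∈ G, a.degree = d) (hd0 : 0 < d) (p : MvPolynomial G K) :
    reesPresentation hI p = 0 ↔ aeval (fun a : G => monomial a.1 (1 : K)) p = 0 := by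
  rw [← Subtype.coe_inj, reesPresentation_coe, ZeroMemClass.coe_zero]
  constructor
  · intro h
    have := congrArg ((Polynomial.aeval (R := MvPolynomial (Fin N) K)
      (1 : MvPolynomial (Fin N) K)).restrictScalars K) h
    rw [comp_aeval_apply, map_zero] at this
    simpa [Polynomial.aeval_monomial] using this
  · intro h
    let τ : MvPolynomial (Fin N) K →ₐ[K] Polynomial (MvPolynomial (Fin N) K) :=
      aeval fun i => Polynomial.monomial 1 (X i)
    have hτ : ∀ a : Fin N →₀ ℕ, τ (monomial a 1) = Polynomial.monomial a.degree (monomial a 1) := by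
      intro a
      rw [aeval_monomial, map_one, one_mul, Finsupp.prod]
      simp only [Polynomial.monomial_pow, one_mul]
      rw [Finsupp.degree_apply, monomial_eq, C_1, one_mul, Finsupp.prod]
      induction a.support using Finset.cons_induction with
      | empty => rfl
      | cons i s hi ih =>
        rw [Finset.prod_cons, Finset.prod_cons, Finset.sum_cons, ih, Polynomial.monomial_mul_monomial]
    have key : Polynomial.expand (MvPolynomial (Fin N) K) d
        (aeval (fun a : G => Polynomial.monomial 1 (monomial a.1 (1 : K))) p) =
        τ (aeval (fun a : G => monomial a.1 (1 : K)) p) := by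
      rw [comp_aeval_apply]
      have := comp_aeval_apply (R := K) (fun a : G => Polynomial.monomial 1 (monomial a.1 (1 : K)))
        ((Polynomial.expand (MvPolynomial (Fin N) K) d).restrictScalars K) p
      refine this.trans ?_
      congr 2
      ext1 a
      rw [hτ, hd a.1 a.2]
      exact (Polynomial.expand_monomial _ _ _).trans (by rw [one_mul])
    rw [h, map_zero] at key
    exact (Polynomial.expand_eq_zero hd0).mp key

/-- The coefficient of `t^k` lies in `𝔪 I^k`, and `I^k ⊆ 𝔪^(dk)`. -/
theorem coeff_mem_pow_of_mem_map (hI : I ≤ idealOfVars (Fin N) K ^ d) {x : reesAlgebra I}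
    (hx : x ∈ (idealOfVars (Fin N) K).map (algebraMap _ (reesAlgebra I))) (k : ℕ) :
    x.1.coeff k ∈ idealOfVars (Fin N) K ^ (d * k + 1) := by
  induction hx using Submodule.span_induction generalizing k with
  | mem x hx =>
    obtain ⟨f, hf, rfl⟩ := hx
    change (Polynomial.C f).coeff k ∈ _
    rw [Polynomial.coeff_C]
    split_ifs with hk
    · simpa [hk] using hf
    · exact zero_mem _
  | zero => simp
  | add x y _ _ hx hy => simpa using add_mem (hx k) (hy k)
  | smul r x _ hx =>
    change (r.1 * x.1).coeff k ∈ _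
    rw [Polynomial.coeff_mul]
    refine sum_mem fun ij hij => ?_
    rw [← Finset.HasAntidiagonal.mem_antidiagonal.mp hij, mul_add, add_assoc, pow_add]
    refine Ideal.mul_mem_mul ?_ (hx _)
    rw [pow_mul]
    exact Ideal.pow_right_mono hI _ (r.2 ij.1)

/-- The presentation of the fiber ring `R(I) / 𝔪 R(I)`. -/
noncomputable def fiberPresentation
    (hI : I = Ideal.span ((fun a => monomial a (1 : K)) '' G)) :
    MvPolynomial G K →+*
      reesAlgebra I ⧸ (idealOfVars (Fin N) K).map
        (algebraMap (MvPolynomial (Fin N) K) (reesAlgebra I)) :=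
  (Ideal.Quotient.mk _).comp (reesPresentation hI : MvPolynomial G K →+* reesAlgebra I)

theorem fiberPresentation_surjective
    (hI : I = Ideal.span ((fun a => monomial a (1 : K)) '' G)) :
    Function.Surjective (fiberPresentation hI) := by
  set M := (idealOfVars (Fin N) K).map (algebraMap (MvPolynomial (Fin N) K) (reesAlgebra I))
  have hC : ∀ s, Ideal.Quotient.mk M (algebraMap (MvPolynomial (Fin N) K) (reesAlgebra I) s) ∈
      (fiberPresentation hI).range := by
    intro s
    -- Modulo `𝔪` a polynomial equals its constant term.
    refine ⟨C (coeff 0 s), ?_⟩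
    change Ideal.Quotient.mk M (reesPresentation hI (C (coeff 0 s))) = _
    rw [algHom_C, IsScalarTower.algebraMap_apply K (MvPolynomial (Fin N) K), Ideal.Quotient.eq,
      ← map_sub]
    refine Ideal.mem_map_of_mem _ ?_
    rw [← pow_one (idealOfVars _ _), mem_pow_idealOfVars_iff']
    intro c hc
    rw [Nat.lt_one_iff, Finsupp.degree_eq_zero_iff] at hc
    simp [hc, algebraMap_eq]
  have hmon : ∀ r, ∀ hr : r ∈ I, Ideal.Quotient.mk M (⟨Polynomial.monomial 1 r,
      reesAlgebra.monomial_mem.mpr (by simpa using hr)⟩ : reesAlgebra I) ∈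
      (fiberPresentation hI).range := by
    intro r hr
    have hr' : r ∈ Ideal.span ((fun a => monomial a (1 : K)) '' G) := hI ▸ hr
    induction hr' using Submodule.span_induction with
    | mem x hx =>
      obtain ⟨a, ha, rfl⟩ := hx
      refine ⟨X ⟨a, ha⟩, ?_⟩
      change Ideal.Quotient.mk M (reesPresentation hI (X ⟨a, ha⟩)) = _
      rw [reesPresentation, aeval_X]
    | zero =>
      convert zero_mem (fiberPresentation hI).range
      rw [Ideal.Quotient.eq_zero_iff_mem]
      convert M.zero_mem
      simp
    | add x y hx hy hx' hy' =>
      have := add_mem (hx' (hI ▸ hx)) (hy' (hI ▸ hy))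
      rw [← map_add] at this
      convert this
      simp
    | smul s x hx hx' =>
      have := mul_mem (hC s) (hx' (hI ▸ hx))
      rw [← map_mul] at this
      convert this
      exact (Polynomial.C_mul_monomial).symm
  intro y
  obtain ⟨x, rfl⟩ := Ideal.Quotient.mk_surjective y
  obtain ⟨x, hx⟩ := x
  have hx' := hx
  rw [← adjoin_monomial_eq_reesAlgebra] at hx'
  change Ideal.Quotient.mk M _ ∈ (fiberPresentation hI).range
  induction hx' using Algebra.adjoin_induction with
  | mem x hx' =>
    obtain ⟨r, hr, rfl⟩ := hx'
    exact hmon r hr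
  | algebraMap r => exact hC r
  | add x y hx' hy' ihx ihy =>
    rw [adjoin_monomial_eq_reesAlgebra] at hx' hy'
    have := add_mem (ihx hx') (ihy hy')
    rwa [← map_add] at this
  | mul x y hx' hy' ihx ihy =>
    rw [adjoin_monomial_eq_reesAlgebra] at hx' hy'
    have := mul_mem (ihx hx') (ihy hy')
    rwa [← map_mul] at this

/-- The coefficient of `t^k` in the image is homogeneous of degree `dk`, whereas membership in `𝔪
R(I)` forces all its terms to have degree at least `dk + 1`. -/
theorem reesPresentation_mem_map_iff
    (hI : I = Ideal.span ((fun a => monomial a (1 : K)) '' G))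
    (hd : ∀ a ∈ G, a.degree = d) (p : MvPolynomial G K) :
    reesPresentation hI p ∈ (idealOfVars (Fin N) K).map (algebraMap _ (reesAlgebra I)) ↔
      reesPresentation hI p = 0 := by
  refine ⟨fun h => ?_, fun h => h ▸ zero_mem _⟩
  have hIm : I ≤ idealOfVars (Fin N) K ^ d := by
    rw [hI, Ideal.span_le]
    rintro _ ⟨a, ha, rfl⟩
    exact (monomial_mem_pow_idealOfVars_iff _ _ one_ne_zero).mpr (hd a ha).ge
  ext k c
  by_contra hc
  have h1 : c.degree = d * k := by
    rw [Finsupp.degree_eq_weight_one]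
    exact isHomogeneous_coeff_reesPresentation hI hd p k hc
  exact hc ((mem_pow_idealOfVars_iff' _ _).mp (coeff_mem_pow_of_mem_map hIm h k) c (by omega))

theorem analyticSpread_eq_ringKrullDim_adjoin
    (hI : I = Ideal.span ((fun a => monomial a (1 : K)) '' G))
    (hd : ∀ a ∈ G, a.degree = d) (hd0 : 0 < d) :
    BorelIdeals.analyticSpread I =
      ringKrullDim (Algebra.adjoin K ((fun a => monomial a (1 : K)) '' G)) := by
  have hker : RingHom.ker (fiberPresentation hI) =
      RingHom.ker (aeval (R := K) fun a : G => monomial a.1 (1 : K)) := by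
    ext p
    rw [RingHom.mem_ker, RingHom.mem_ker, ← reesPresentation_eq_zero_iff hI hd hd0,
      ← reesPresentation_mem_map_iff hI hd, ← Ideal.Quotient.eq_zero_iff_mem]
    rfl
  have hrange : (aeval (R := K) fun a : G => monomial a.1 (1 : K)).range =
      Algebra.adjoin K ((fun a => monomial a (1 : K)) '' G) := by
    rw [← Algebra.adjoin_range_eq_range_aeval, Set.image_eq_range]
  rw [← hrange]
  refine (ringKrullDim_eq_of_ringEquiv (RingHom.quotientKerEquivOfSurjective
    (fiberPresentation_surjective hI))).symm.trans ?_
  rw [hker]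
  exact ringKrullDim_eq_of_ringEquiv
    (Ideal.quotientKerEquivRange
      (aeval (R := K) fun a : G => monomial a.1 (1 : K))).toRingEquiv

end FiberRing

/-! ### Rank of the exponent vectors. -/

section ExponentRank

variable {N : ℕ} {G : Set (Fin N →₀ ℕ)} {r n d : ℕ}

theorem exponentCast_exchange {a : Fin N →₀ ℕ} {i j : Fin N} (ha : a j = 1) :
    exponentCast (Fin N) (a - Finsupp.single j 1 + Finsupp.single i 1) =
      exponentCast (Fin N) a - Pi.single j 1 + Pi.single i 1 := by
  have : Finsupp.single j 1 ≤ a := by rw [Finsupp.single_le_iff, ha]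
  have hs : ∀ l : Fin N, exponentCast (Fin N) (Finsupp.single l 1) = Pi.single l 1 := by
    intro l
    ext t
    simp [Finsupp.single_apply, Pi.single_apply, eq_comm]
  rw [map_add, hs, eq_sub_of_add_eq (a := exponentCast (Fin N) (a - Finsupp.single j 1))]
  rw [← hs j, ← map_add, tsub_add_cancel_of_le this]

theorem single_sub_single_mem_span {a : Fin N →₀ ℕ} {i j : Fin N} (haG : a ∈ G) (ha : a j = 1)
    (hG : a - Finsupp.single j 1 + Finsupp.single i 1 ∈ G) :
    Pi.single i 1 - Pi.single j 1 ∈ Submodule.span ℚ (exponentCast (Fin N) '' G) := by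
  have h1 := Submodule.subset_span (R := ℚ) (Set.mem_image_of_mem (exponentCast (Fin N)) haG)
  have h2 := Submodule.subset_span (R := ℚ) (Set.mem_image_of_mem (exponentCast (Fin N)) hG)
  rw [exponentCast_exchange ha] at h2
  convert sub_mem h2 h1 using 1
  abel

theorem card_filter_val_lt_le (N r : ℕ) :
    (Finset.univ.filter fun i : Fin N => i.val < r).card ≤ r := by
  calc _ ≤ (Finset.range r).card := Finset.card_le_card_of_injOn Fin.val
        (by intro i hi; simpa using hi) Fin.val_injective.injOn
    _ = r := Finset.card_range r

theorem exists_isGreatest_support (hsq : ∀ a ∈ G, ∀ i, a i ≤ 1) (hdeg : ∀ a ∈ G, a.degree = d)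
    (hrd : r < d) {a : Fin N →₀ ℕ} (ha : a ∈ G) :
    ∃ p : Fin N, r ≤ p.val ∧ a p = 1 ∧ ∀ q, p < q → a q = 0 := by
  obtain ⟨p, hrp, hp⟩ : ∃ p : Fin N, r ≤ p.val ∧ a p ≠ 0 := by
    by_contra! h
    have h1 := hdeg a ha
    rw [Finsupp.degree_eq_sum] at h1
    have h2 : ∑ i, a i ≤ ∑ i : Fin N, if i.val < r then 1 else 0 := by
      refine Finset.sum_le_sum fun i _ => ?_
      split_ifs with hi
      · exact hsq a ha i
      · exact (h i (not_lt.mp hi)).le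
    rw [← Finset.card_filter] at h2
    have := card_filter_val_lt_le N r
    omega
  have hne : a.support.Nonempty := ⟨p, by simpa using hp⟩
  refine ⟨a.support.max' hne, ?_, ?_, ?_⟩
  · exact hrp.trans (Finset.le_max' _ p (by simpa using hp))
  · have h1 := Finset.max'_mem _ hne
    rw [Finsupp.mem_support_iff] at h1
    have := hsq a ha (a.support.max' hne)
    omega
  · intro q hq
    by_contra hq'
    exact absurd (Finset.le_max' _ q (by simpa using hq')) (not_le.mpr hq)

/-- An exchange inside `G` puts the difference of two unit vectors in the span. Up to the last
variable `p` of `u`, exchanges on `u`, which misses `s`, suffice. Beyond `p`, exchanges start from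
`v`, which contains `x_n`, and may need an intermediate index `q ≤ p`. -/
theorem single_sub_single_mem_span_of_exchange
    (hsq : ∀ a ∈ G, ∀ i, a i ≤ 1) (hdeg : ∀ a ∈ G, a.degree = d)
    (hlow : ∀ a ∈ G, ∀ i : Fin N, i.val < r → a i = 1)
    (hex : ∀ a ∈ G, ∀ i j : Fin N, i < j → a j = 1 → a i = 0 →
      a - Finsupp.single j 1 + Finsupp.single i 1 ∈ G)
    (hrd : r < d) {v : Fin N →₀ ℕ} (hv : v ∈ G) {t : Fin N} (ht : t.val + 1 = n) (hvt : v t = 1)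
    {u : Fin N →₀ ℕ} (hu : u ∈ G) {s : Fin N} (hs : s.val = r) (hus : u s = 0)
    {j : Fin N} (hsj : s < j) (hjn : j.val < n) :
    Pi.single s 1 - Pi.single j 1 ∈ Submodule.span ℚ (exponentCast (Fin N) '' G) := by
  obtain ⟨p, hrp, hp, hmax⟩ := exists_isGreatest_support hsq hdeg hrd hu
  have move : ∀ a ∈ G, ∀ l q : Fin N, l ≤ q → a q = 1 → ∃ b ∈ G, b l = 1 ∧
      ∀ x, x ≠ l → b x ≤ a x := by
    intro a ha l q hlq haq
    have := hsq a ha l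
    obtain h | h : a l = 1 ∨ a l = 0 := by omega
    · exact ⟨a, ha, h, fun _ _ => le_rfl⟩
    · have hlq' : l < q := lt_of_le_of_ne hlq (by rintro rfl; omega)
      refine ⟨_, hex a ha l q hlq' haq h, ?_, ?_⟩
      · simp [h]
      · intro x hx
        simp [hx.symm]
  have direct : ∀ a ∈ G, ∀ i l : Fin N, i < l → a l = 1 → a i = 0 →
      Pi.single i 1 - Pi.single l 1 ∈ Submodule.span ℚ (exponentCast (Fin N) '' G) :=
    fun a ha i l hil hl hi => single_sub_single_mem_span ha hl (hex a ha i l hil hl hi)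
  have below : ∀ l : Fin N, s < l → l ≤ p →
      Pi.single s 1 - Pi.single l 1 ∈ Submodule.span ℚ (exponentCast (Fin N) '' G) := by
    intro l hsl hlp
    obtain ⟨b, hb, hbl, hbx⟩ := move u hu l p hlp hp
    exact direct b hb s l hsl hbl (Nat.le_zero.mp (hus ▸ hbx s hsl.ne))
  obtain hjp | hpj := le_or_gt j p
  · exact below j hsj hjp
  obtain ⟨w, hw, hwj, -⟩ := move v hv j t (Fin.le_def.mpr (by omega)) hvt
  by_cases hws : w s = 0
  · exact direct w hw s j hsj hwj hws
  -- Without such a `q`, `w` would dominate `u` everywhere and strictly at `s`, contradicting equal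
  -- degrees.
  obtain ⟨q, hsq', hqp, hq⟩ : ∃ q, s < q ∧ q ≤ p ∧ w q = 0 := by
    by_contra! h
    have hlt : ∑ i, u i < ∑ i, w i := by
      refine Finset.sum_lt_sum (fun i _ => ?_) ⟨s, Finset.mem_univ _, by omega⟩
      obtain hip | hip := le_or_gt i p
      · refine (hsq u hu i).trans ?_
        obtain hi | hi | hi := lt_trichotomy i s
        · exact (hlow w hw i (by rw [← hs]; exact hi)).ge
        · subst hi; omega
        · have := h i hi hip; omega
      · rw [hmax i hip]; exact Nat.zero_le _
    rw [← Finsupp.degree_eq_sum, ← Finsupp.degree_eq_sum, hdeg u hu, hdeg w hw] at hlt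
    exact lt_irrefl _ hlt
  convert add_mem (below q hsq' hqp) (direct w hw q j (hqp.trans_lt hpj) hwj hq) using 1
  abel

theorem eq_zero_of_mem_span_of_forall_eq_zero
    (hdeg : ∀ a ∈ G, a.degree = d)
    (hlow : ∀ a ∈ G, ∀ i : Fin N, i.val < r → a i = 1)
    (hhigh : ∀ a ∈ G, ∀ i : Fin N, n ≤ i.val → a i = 0) (hrd : r < d)
    {x : Fin N → ℚ} (hx : x ∈ Submodule.span ℚ (exponentCast (Fin N) '' G))
    (h0 : ∀ i : Fin N, r ≤ i.val → i.val < n → x i = 0) : x = 0 := by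
  have key : (∀ i : Fin N, n ≤ i.val → x i = 0) ∧
      ∀ i : Fin N, i.val < r → d * x i = ∑ j, x j := by
    clear h0
    induction hx using Submodule.span_induction with
    | mem x hx =>
      obtain ⟨a, ha, rfl⟩ := hx
      refine ⟨fun i hi => by simp [hhigh a ha i hi], fun i hi => ?_⟩
      simp only [exponentCast_apply, hlow a ha i hi, ← Nat.cast_sum, ← Finsupp.degree_eq_sum,
        hdeg a ha, Nat.cast_one, mul_one]
    | zero => simp
    | add x y _ _ hx hy =>
      refine ⟨fun i hi => by simp [hx.1 i hi, hy.1 i hi], fun i hi => ?_⟩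
      simp [mul_add, Finset.sum_add_distrib, hx.2 i hi, hy.2 i hi]
    | smul c x _ hx =>
      refine ⟨fun i hi => by simp [hx.1 i hi], fun i hi => ?_⟩
      simp only [Pi.smul_apply, smul_eq_mul, ← Finset.mul_sum, ← hx.2 i hi]
      ring
  have hzero : ∀ i : Fin N, ¬ i.val < r → x i = 0 := fun i hi =>
    (lt_or_ge i.val n).elim (h0 i (not_lt.mp hi)) (key.1 i)
  have hd : (d : ℚ) ≠ 0 := by
    have : d ≠ 0 := by omega
    exact_mod_cast this
  have hsum : ∑ j, x j = 0 := by
    -- Only the low coordinates survive, and each is `1/d` of the sum; there are at most `r < d` of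
    -- them, so the sum vanishes.
    have h1 : d * ∑ j, x j =
        (Finset.univ.filter fun i : Fin N => i.val < r).card * ∑ j, x j := by
      rw [Finset.mul_sum, ← nsmul_eq_mul, ← Finset.sum_const, Finset.sum_filter]
      refine Finset.sum_congr rfl fun i _ => ?_
      split_ifs with hi
      · exact key.2 i hi
      · rw [hzero i hi, mul_zero]
    rw [mul_eq_mul_right_iff] at h1
    refine h1.resolve_left fun h => ?_
    have h2 : d = _ := Nat.cast_injective h
    have := card_filter_val_lt_le N r
    omega
  ext i
  by_cases hi : i.val < r
  · exact (mul_eq_zero.mp ((key.2 i hi).trans hsum)).resolve_left hd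
  · exact hzero i hi

/-- Projection to the coordinates in `[r, n)` is bijective on the span. -/
theorem finrank_span_exponents
    (hsq : ∀ a ∈ G, ∀ i, a i ≤ 1) (hdeg : ∀ a ∈ G, a.degree = d)
    (hlow : ∀ a ∈ G, ∀ i : Fin N, i.val < r → a i = 1)
    (hhigh : ∀ a ∈ G, ∀ i : Fin N, n ≤ i.val → a i = 0)
    (hex : ∀ a ∈ G, ∀ i j : Fin N, i < j → a j = 1 → a i = 0 →
      a - Finsupp.single j 1 + Finsupp.single i 1 ∈ G)
    (hrd : r < d) {v : Fin N →₀ ℕ} (hv : v ∈ G) {t : Fin N} (ht : t.val + 1 = n) (hvt : v t = 1)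
    {u : Fin N →₀ ℕ} (hu : u ∈ G) {s : Fin N} (hs : s.val = r) (hus : u s = 0) :
    Module.finrank ℚ (Submodule.span ℚ (exponentCast (Fin N) '' G)) = n - r := by
  obtain ⟨p, hrp, hp, -⟩ := exists_isGreatest_support hsq hdeg hrd hu
  have hpn : p.val < n := by
    by_contra h
    have := hhigh u hu p (not_lt.mp h)
    omega
  let T := {i : Fin N // r ≤ i.val ∧ i.val < n}
  let π : (Fin N → ℚ) →ₗ[ℚ] (T → ℚ) := LinearMap.funLeft ℚ ℚ Subtype.val
  set V := Submodule.span ℚ (exponentCast (Fin N) '' G)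
  have hinj : Function.Injective (π.domRestrict V) := by
    rw [injective_iff_map_eq_zero]
    intro x hx
    exact Subtype.ext (eq_zero_of_mem_span_of_forall_eq_zero hdeg hlow hhigh hrd x.2
      fun i h1 h2 => congrFun hx ⟨i, h1, h2⟩)
  let s' : T := ⟨s, hs.ge, by omega⟩
  have hsingle : ∀ j : T, π (Pi.single j.1 1) = Pi.single j 1 := by
    intro j
    ext i
    simp only [π, LinearMap.funLeft_apply, Pi.single_apply]
    exact if_congr Subtype.ext_iff.symm rfl rfl
  have hdiff : ∀ j : T, Pi.single s' 1 - Pi.single j 1 ∈ V.map π := by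
    intro j
    obtain h | h := eq_or_ne s' j
    · rw [h, sub_self]; exact zero_mem _
    · have hsj : s < j.1 := by
        refine lt_of_le_of_ne (Fin.le_def.mpr (by rw [hs]; exact j.2.1)) fun h' => h (Subtype.ext h')
      have := Submodule.mem_map_of_mem (f := π) (single_sub_single_mem_span_of_exchange hsq hdeg hlow
        hex hrd hv ht hvt hu hs hus hsj j.2.2)
      rwa [map_sub, hsingle, show π (Pi.single s 1) = _ from hsingle s'] at this
  have hs'mem : (Pi.single s' 1 : T → ℚ) ∈ V.map π := by
    have h1 : π (exponentCast (Fin N) u) ∈ V.map π :=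
      Submodule.mem_map_of_mem (Submodule.subset_span ⟨u, hu, rfl⟩)
    -- Modulo the differences `e_s - e_j`, the projection of `u` is its coordinate sum times `e_s`.
    -- The sum is positive because `p` lies in `T`.
    have h2 : (∑ j : T, (u j.1 : ℚ)) • (Pi.single s' 1 : T → ℚ) = π (exponentCast (Fin N) u) +
        ∑ j : T, (u j.1 : ℚ) • ((Pi.single s' 1 : T → ℚ) - Pi.single j 1) := by
      have : π (exponentCast (Fin N) u) = ∑ j : T, (u j.1 : ℚ) • (Pi.single j 1 : T → ℚ) := by
        ext i
        simp [π, LinearMap.funLeft_apply, Finset.sum_apply, Pi.single_apply]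
      rw [this, ← Finset.sum_add_distrib, Finset.sum_smul]
      exact Finset.sum_congr rfl fun j _ => by rw [smul_sub]; abel
    have h3 := add_mem h1 (sum_mem fun (j : T) (_ : j ∈ Finset.univ) =>
      (V.map π).smul_mem (u j.1 : ℚ) (hdiff j))
    rw [← h2] at h3
    refine ((V.map π).smul_mem_iff (ne_of_gt ?_)).mp h3
    refine Finset.sum_pos' (fun _ _ => Nat.cast_nonneg _) ⟨⟨p, hrp, hpn⟩, Finset.mem_univ _, ?_⟩
    simp [hp]
  have hsurj : Function.Surjective (π.domRestrict V) := by
    rw [← LinearMap.range_eq_top, LinearMap.range_domRestrict, eq_top_iff,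
      ← (Pi.basisFun ℚ T).span_eq, Submodule.span_le]
    rintro _ ⟨j, rfl⟩
    have := sub_mem hs'mem (hdiff j)
    rw [sub_sub_cancel] at this
    simpa using this
  rw [(LinearEquiv.ofBijective _ ⟨hinj, hsurj⟩).finrank_eq, Module.finrank_fintype_fun_eq_card,
    Fintype.card_subtype, ← Nat.card_Ico, ← Finset.card_map Fin.valEmbedding]
  congr 1
  ext i
  simp only [Finset.mem_map, Finset.mem_filter, Finset.mem_univ, true_and, Fin.valEmbedding_apply,
    Finset.mem_Ico]
  constructor
  · rintro ⟨j, hj, rfl⟩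
    exact hj
  · intro hi
    exact ⟨⟨i, by omega⟩, hi, rfl⟩

end ExponentRank

/-! ### Minimal generators of squarefree Borel ideals. -/

section BorelIdeal

open BorelIdeals MvPolynomial

variable {K : Type*} [Field K] {N : ℕ}

theorem monomial_mem_span_monomial_iff {A : Set (Fin N →₀ ℕ)} {a : Fin N →₀ ℕ} :
    monomial a (1 : K) ∈ Ideal.span ((fun a => monomial a (1 : K)) '' A) ↔ ∃ b ∈ A, b ≤ a := by
  classical
  rw [mem_ideal_span_monomial_image, support_monomial, if_neg one_ne_zero]
  simp

theorem isKBounded_exchange {a : Fin N →₀ ℕ} (ha : IsKBounded 1 a) {i j : Fin N}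
    (hi : a i = 0) : IsKBounded 1 (a - Finsupp.single j 1 + Finsupp.single i 1) := by
  intro l
  have := ha l
  obtain rfl | h := eq_or_ne i l
  · simp [hi]
  · simp only [Finsupp.add_apply, Finsupp.tsub_apply, Finsupp.single_eq_of_ne h.symm]
    omega

theorem degree_exchange {a : Fin N →₀ ℕ} {i j : Fin N} (hj : a j = 1) :
    (a - Finsupp.single j 1 + Finsupp.single i 1).degree = a.degree := by
  have h : Finsupp.single j 1 ≤ a := by rw [Finsupp.single_le_iff, hj]
  conv_rhs => rw [← tsub_add_cancel_of_le h]
  simp only [map_add, Finsupp.degree_single]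

theorem eq_of_le_of_degree_eq {a b : Fin N →₀ ℕ} (h : a ≤ b) (hd : a.degree = b.degree) : a = b := by
  rw [← tsub_add_cancel_of_le h, map_add] at hd
  have : (b - a).degree = 0 := by omega
  rw [Finsupp.degree_eq_zero_iff] at this
  rw [← tsub_add_cancel_of_le h, this, zero_add]

variable {m : ℕ} {u : Fin m → Fin N →₀ ℕ}

theorem borelIdeal_le {J : Ideal (MvPolynomial (Fin N) K)} (hJ : IsKBorel 1 J)
    (hu : ∀ i, monomial (u i) (1 : K) ∈ J) : borelIdeal K 1 u ≤ J :=
  sInf_le ⟨hJ, hu⟩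

theorem monomial_exchange_mem_borelIdeal {a : Fin N →₀ ℕ} (ha : IsKBounded 1 a)
    (haI : monomial a (1 : K) ∈ borelIdeal K 1 u) {i j : Fin N} (hij : i < j) (hj : a j = 1)
    (hi : a i = 0) :
    monomial (a - Finsupp.single j 1 + Finsupp.single i 1) (1 : K) ∈ borelIdeal K 1 u := by
  rw [borelIdeal, Submodule.mem_sInf] at haI ⊢
  intro J hJ
  exact hJ.1.2 a ha (haI J hJ) i j (by simp [hj]) hij (isKBounded_exchange ha hi)

theorem exists_isKBounded_le_of_mem_borelIdeal {f : MvPolynomial (Fin N) K}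
    (hf : f ∈ borelIdeal K 1 u) {c : Fin N →₀ ℕ} (hc : c ∈ f.support) :
    ∃ b ≤ c, IsKBounded 1 b ∧ monomial b (1 : K) ∈ borelIdeal K 1 u := by
  -- Different ideals `J` may supply different squarefree divisors of `c`; the squarefree part `c ⊓
  -- e` is a multiple of all of them, so it lies in every `J`.
  let e : Fin N →₀ ℕ := Finsupp.equivFunOnFinite.symm fun _ => 1
  refine ⟨c ⊓ e, inf_le_left, fun i => by simp [e], ?_⟩
  rw [borelIdeal, Submodule.mem_sInf] at hf ⊢
  intro J hJ
  obtain ⟨A, hA, rfl⟩ := hJ.1.1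
  obtain ⟨b, hb, hbc⟩ := mem_ideal_span_monomial_image.mp (hf _ hJ) c hc
  exact monomial_mem_span_monomial_iff.mpr ⟨b, hb, le_inf hbc (hA b hb)⟩

theorem isKBounded_of_mem_minGens {a : Fin N →₀ ℕ} (ha : a ∈ minGens (borelIdeal K 1 u)) :
    IsKBounded 1 a := by
  obtain ⟨b, hba, hb, hbI⟩ := exists_isKBounded_le_of_mem_borelIdeal ha.1 (c := a) (by simp)
  rwa [← le_antisymm hba (ha.2 hbI hba)]

theorem borelIdeal_eq_span_minGens : borelIdeal K 1 u =
    Ideal.span ((fun a => monomial a (1 : K)) '' minGens (borelIdeal K 1 u)) := by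
  apply le_antisymm
  · intro f hf
    rw [mem_ideal_span_monomial_image]
    intro c hc
    obtain ⟨b, hbc, -, hb⟩ := exists_isKBounded_le_of_mem_borelIdeal hf hc
    obtain ⟨g, hgb, hg⟩ := exists_minimal_le_of_wellFoundedLT
      (fun b => monomial b (1 : K) ∈ borelIdeal K 1 u) b hb
    exact ⟨g, hg, hgb.trans hbc⟩
  · rw [Ideal.span_le]
    rintro _ ⟨a, ha, rfl⟩
    exact ha.1

theorem finite_minGens_borelIdeal : (minGens (borelIdeal K 1 u)).Finite :=
  (Set.finite_Icc 0 (Finsupp.equivFunOnFinite.symm fun _ => 1)).subset fun _ ha =>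
    ⟨zero_le, isKBounded_of_mem_minGens ha⟩

theorem mem_minGens_of_degree {I : Ideal (MvPolynomial (Fin N) K)} {d : ℕ}
    (hd : ∀ a ∈ minGens I, a.degree = d) {a : Fin N →₀ ℕ} (ha : monomial a (1 : K) ∈ I)
    (had : a.degree = d) : a ∈ minGens I := by
  obtain ⟨g, hga, hg⟩ := exists_minimal_le_of_wellFoundedLT (fun b => monomial b (1 : K) ∈ I) a ha
  rwa [← eq_of_le_of_degree_eq hga ((hd g hg).trans had.symm)]

/-- This is a comparison ideal: by minimality `borelIdeal` is contained in it, so the generators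
inherit the constraints on low and high variables. -/
theorem isKBorel_span_low_high (d r n : ℕ) :
    IsKBorel 1 (Ideal.span ((fun a => monomial a (1 : K)) '' {a : Fin N →₀ ℕ | IsKBounded 1 a ∧
      a.degree = d ∧ (∀ i : Fin N, i.val < r → a i = 1) ∧ ∀ i : Fin N, n ≤ i.val → a i = 0})) := by
  refine ⟨⟨_, fun a ha => ha.1, rfl⟩, ?_⟩
  intro a ha haI i j hj hij hbd
  rw [monomial_mem_span_monomial_iff] at haI ⊢
  obtain ⟨b, ⟨hb1, hbd', hlow, hhigh⟩, hba⟩ := haI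
  have haj : a j = 1 := by
    have := ha j
    have := Finsupp.mem_support_iff.mp hj
    omega
  have hai : a i = 0 := by
    have := hbd i
    simp [hij.ne] at this
    exact this
  have hbi : b i = 0 := Nat.le_zero.mp (hai ▸ hba i)
  -- If `x_j` does not divide `b`, then `b` still divides the exchanged monomial. Otherwise the same
  -- exchange applies to `b`, and `r ≤ i < j < n` keeps the constraints.
  obtain hbj | hbj : b j = 0 ∨ b j = 1 := by have := hb1 j; omega
  · refine ⟨b, ⟨hb1, hbd', hlow, hhigh⟩, fun l => ?_⟩
    obtain rfl | hl := eq_or_ne l j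
    · simp [hbj]
    · have := hba l
      simp only [Finsupp.add_apply, Finsupp.tsub_apply, Finsupp.single_eq_of_ne hl]
      omega
  · have hri : r ≤ i.val := by
      by_contra h
      have := hlow i (not_le.mp h)
      omega
    have hij' : i.val < j.val := hij
    have hjn : j.val < n := by
      by_contra h
      have := hhigh j (not_lt.mp h)
      omega
    refine ⟨b - Finsupp.single j 1 + Finsupp.single i 1, ⟨isKBounded_exchange hb1 hbi,
      (degree_exchange hbj).trans hbd', ?_, ?_⟩, add_le_add_left (tsub_le_tsub_right hba _) _⟩
    · intro l hl
      have h1 : l ≠ i := by rintro rfl; omega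
      have h2 : l ≠ j := by rintro rfl; omega
      simp [Finsupp.single_eq_of_ne, h1, h2, hlow l hl]
    · intro l hl
      have h1 : l ≠ i := by rintro rfl; omega
      simp [Finsupp.single_eq_of_ne, h1, hhigh l hl]

/-- The first `r` variables already exhaust the degree, so no other variable can occur. -/
theorem eq_of_degree_le {r d : ℕ} (hdr : d ≤ r) {a b : Fin N →₀ ℕ} (ha : a.degree = d)
    (hb : b.degree = d) (hla : ∀ i : Fin N, i.val < r → a i = 1)
    (hlb : ∀ i : Fin N, i.val < r → b i = 1) : a = b := by
  have h0 : ∀ c : Fin N →₀ ℕ, c.degree = d → (∀ i : Fin N, i.val < r → c i = 1) →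
      ∀ i : Fin N, r ≤ i.val → c i = 0 := by
    intro c hc hlc i hi
    have hiN := i.2
    have h1 : ∑ l ∈ insert i (Finset.Iio (⟨r, by omega⟩ : Fin N)), c l ≤ c.degree := by
      rw [Finsupp.degree_eq_sum]
      exact Finset.sum_le_sum_of_subset (Finset.subset_univ _)
    rw [Finset.sum_insert (by simpa [Fin.le_def] using hi), Finset.sum_congr rfl fun l hl =>
      hlc l (by simpa [Fin.lt_def] using hl), Finset.sum_const, Fin.card_Iio] at h1
    simp only [smul_eq_mul, mul_one] at h1
    omega
  ext i
  obtain hi | hi := lt_or_ge i.val r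
  · rw [hla i hi, hlb i hi]
  · rw [h0 a ha hla i hi, h0 b hb hlb i hi]

theorem analyticSpread_borelIdeal {d n r : ℕ} (hu : ∀ i, IsKBounded 1 (u i))
    (hd : ∀ a ∈ minGens (borelIdeal K 1 u), a.degree = d)
    (hmin : ∀ i, u i ∈ minGens (borelIdeal K 1 u))
    (hprincipal : ¬ Submodule.IsPrincipal (borelIdeal K 1 u))
    (hlow : ∀ i, ∀ j : Fin N, j.val < r → u i j = 1)
    (hlow' : ∀ s : Fin N, s.val = r → ∃ i, u i s = 0)
    (hhigh : ∀ i, ∀ j : Fin N, n ≤ j.val → u i j = 0)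
    (hhigh' : ∃ i, ∃ t : Fin N, t.val + 1 = n ∧ u i t = 1) :
    analyticSpread (borelIdeal K 1 u) = ((n - r : ℕ) : WithBot ℕ∞) := by
  set G := minGens (borelIdeal K 1 u) with hGdef
  have hI : borelIdeal K 1 u = Ideal.span ((fun a => monomial a (1 : K)) '' G) :=
    borelIdeal_eq_span_minGens
  have hsq : ∀ a ∈ G, ∀ i, a i ≤ 1 := fun a ha => isKBounded_of_mem_minGens ha
  have hsub : ∀ a ∈ G, (∀ i : Fin N, i.val < r → a i = 1) ∧ ∀ i : Fin N, n ≤ i.val → a i = 0 := by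
    intro a ha
    have := borelIdeal_le (isKBorel_span_low_high d r n) (fun i =>
      monomial_mem_span_monomial_iff.mpr
        ⟨u i, ⟨hu i, hd _ (hmin i), hlow i, hhigh i⟩, le_rfl⟩) ha.1
    obtain ⟨b, hb, hba⟩ := monomial_mem_span_monomial_iff.mp this
    rw [← eq_of_le_of_degree_eq hba (hb.2.1.trans (hd a ha).symm)]
    exact hb.2.2
  obtain ⟨i, t, ht, hvt⟩ := hhigh'
  -- Otherwise all generators coincide and the ideal is principal.
  have hrd : r < d := by
    by_contra h
    refine hprincipal ⟨monomial (u i) 1, ?_⟩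
    have : G = {u i} := by
      ext a
      refine ⟨fun ha => ?_, fun ha => ?_⟩
      · exact eq_of_degree_le (not_lt.mp h) (hd a ha) (hd _ (hmin i)) (hsub a ha).1 (hlow i)
      · rw [Set.mem_singleton_iff.mp ha]
        exact hmin i
    rw [hI, this, Set.image_singleton]
  -- With `r < d` this makes `r` a valid index, so `hlow'` is not vacuous.
  have hdN : d ≤ N := by
    rw [← hd _ (hmin i), Finsupp.degree_eq_sum]
    exact (Finset.sum_le_sum fun j _ => hu i j).trans (by simp)
  obtain ⟨i', hi'⟩ := hlow' ⟨r, hrd.trans_le hdN⟩ rfl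
  rw [analyticSpread_eq_ringKrullDim_adjoin hI hd (by omega),
    ringKrullDim_adjoin_monomial finite_minGens_borelIdeal,
    finrank_span_exponents hsq hd (fun a ha => (hsub a ha).1) (fun a ha => (hsub a ha).2) ?_ hrd
      (hmin i) ht hvt (hmin i') rfl hi']
  intro a ha i j hij hj hi
  exact mem_minGens_of_degree hd (monomial_exchange_mem_borelIdeal (hsq a ha) ha.1 hij hj hi)
    ((degree_exchange hj).trans (hd a ha))

theorem isKBorel_bot : IsKBorel 1 (⊥ : Ideal (MvPolynomial (Fin N) K)) := by
  refine ⟨⟨∅, by simp, by simp⟩, fun a _ ha => ?_⟩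
  rw [Ideal.mem_bot, monomial_eq_zero] at ha
  exact absurd ha one_ne_zero

theorem nonempty_of_not_isPrincipal_borelIdeal
    (h : ¬ Submodule.IsPrincipal (borelIdeal K 1 u)) : Nonempty (Fin m) := by
  by_contra hm
  rw [not_nonempty_iff] at hm
  refine h ?_
  rw [eq_bot_iff.mpr (borelIdeal_le isKBorel_bot fun i => isEmptyElim i)]
  exact bot_isPrincipal

end BorelIdeal

/-! ### First blocks, and the theorem. -/

section Blocks

open BorelIdeals

variable {N : ℕ} {a : Fin N →₀ ℕ} {B : Finset ℕ}

theorem mem_supp_iff {p : ℕ} : p ∈ supp a ↔ ∃ j : Fin N, a j ≠ 0 ∧ j.val + 1 = p := by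
  simp [supp]

theorem succ_mem_supp_iff {j : Fin N} : j.val + 1 ∈ supp a ↔ a j ≠ 0 := by
  rw [mem_supp_iff]
  constructor
  · rintro ⟨l, hl, h⟩
    rwa [← Fin.ext (show l.val = j.val by omega)]
  · intro h
    exact ⟨j, h, rfl⟩

theorem one_le_of_mem_supp {p : ℕ} (hp : p ∈ supp a) : 1 ≤ p := by
  obtain ⟨j, -, rfl⟩ := mem_supp_iff.mp hp
  omega

theorem IsFirstBlock.one_mem (hB : IsFirstBlock a B) (h : 1 ∈ supp a) : 1 ∈ B := by
  obtain ⟨i, hi, hmin⟩ := hB.2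
  have := hmin 1 h
  have := one_le_of_mem_supp (hB.1.1.2 hi)
  rwa [show (1 : ℕ) = i by omega]

theorem IsFirstBlock.exists_eq_Icc (hB : IsFirstBlock a B) (h : 1 ∈ B) :
    ∃ q, 1 ≤ q ∧ B = Finset.Icc 1 q ∧ B ⊆ supp a ∧ q + 1 ∉ supp a := by
  obtain ⟨⟨⟨⟨p, q, hpq, rfl⟩, hsub⟩, hmax⟩, -⟩ := hB
  have hp : p = 1 := le_antisymm (Finset.mem_Icc.mp h).1
    (one_le_of_mem_supp (hsub (Finset.left_mem_Icc.mpr hpq)))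
  subst hp
  -- If `q + 1` were in the support, the block could be extended, against maximality.
  refine ⟨q, hpq, rfl, hsub, fun hq => ?_⟩
  have hblock : IsBlock a (Finset.Icc 1 (q + 1)) := by
    refine ⟨⟨1, q + 1, by omega, rfl⟩, fun x hx => ?_⟩
    obtain ⟨h1, h2⟩ := Finset.mem_Icc.mp hx
    obtain h2 | rfl : x ≤ q ∨ x = q + 1 := by omega
    · exact hsub (Finset.mem_Icc.mpr ⟨h1, h2⟩)
    · exact hq
  have := hmax hblock (Finset.Icc_subset_Icc_right (Nat.le_succ q))
    (Finset.right_mem_Icc.mpr (by omega))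
  rw [Finset.mem_Icc] at this
  omega

theorem supp_nonempty_of_isFirstBlock (hB : IsFirstBlock a B) : (supp a).Nonempty := by
  obtain ⟨i, hi, -⟩ := hB.2
  exact ⟨i, hB.1.1.2 hi⟩

end Blocks

theorem theorem3p3 {K : Type*} [Field K] {N m : ℕ}
    (I : Ideal (MvPolynomial (Fin N) K)) (u : Fin m → Fin N →₀ ℕ) (B : Fin m → Finset ℕ) (n : ℕ)
    (hu : ∀ i, BorelIdeals.IsKBounded 1 (u i))
    (hI : I = BorelIdeals.borelIdeal K 1 u)
    (hequi : BorelIdeals.IsEquigenerated I)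
    (hmin : ∀ i, u i ∈ BorelIdeals.minGens I)
    (hprincipal : ¬ Submodule.IsPrincipal I)
    (hB : ∀ i, BorelIdeals.IsFirstBlock (u i) (B i))
    (hn : n = Finset.univ.sup (fun i => BorelIdeals.maxSupp (u i))) :
    (1 ∉ ⋂ i, (B i : Set ℕ) → BorelIdeals.analyticSpread I = (n : WithBot ℕ∞)) ∧
    (1 ∈ ⋂ i, (B i : Set ℕ) →
      BorelIdeals.analyticSpread I = ((n - (⋂ i, (B i : Set ℕ)).ncard : ℕ) : WithBot ℕ∞)) := by
  subst hI
  obtain ⟨d, hd⟩ := hequi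
  have hne := nonempty_of_not_isPrincipal_borelIdeal hprincipal
  have hone : ∀ i j, u i j ≠ 0 → u i j = 1 := by
    intro i j h
    have := hu i j
    omega
  have hhigh : ∀ i, ∀ j : Fin N, n ≤ j.val → u i j = 0 := by
    intro i j hj
    by_contra h
    have h1 : j.val + 1 ≤ BorelIdeals.maxSupp (u i) :=
      Finset.le_sup (f := id) (succ_mem_supp_iff.mpr h)
    have h2 : BorelIdeals.maxSupp (u i) ≤ n :=
      hn ▸ Finset.le_sup (f := fun i => BorelIdeals.maxSupp (u i)) (Finset.mem_univ i)
    omega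
  have hhigh' : ∃ i, ∃ t : Fin N, t.val + 1 = n ∧ u i t = 1 := by
    -- Both suprema are over nonempty sets, so `n` is attained at an actual variable and is not the
    -- default value 0.
    obtain ⟨i, -, hi⟩ := Finset.exists_mem_eq_sup Finset.univ Finset.univ_nonempty
      (fun i => BorelIdeals.maxSupp (u i))
    obtain ⟨p, hp, hpi⟩ := Finset.exists_mem_eq_sup _ (supp_nonempty_of_isFirstBlock (hB i)) id
    obtain ⟨t, ht, htp⟩ := mem_supp_iff.mp hp
    exact ⟨i, t, by rw [htp, hn, hi]; exact hpi.symm, hone i t ht⟩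
  constructor
  · intro h
    rw [Set.mem_iInter, not_forall] at h
    obtain ⟨i, hi⟩ := h
    refine analyticSpread_borelIdeal (r := 0) hu hd hmin hprincipal (by simp)
      (fun s hs => ⟨i, ?_⟩) hhigh hhigh'
    by_contra hsi
    refine hi (IsFirstBlock.one_mem (hB i) ?_)
    have := succ_mem_supp_iff.mpr hsi
    rwa [hs] at this
  · intro h
    rw [Set.mem_iInter] at h
    choose q hq hBq hsub hnot using fun i => IsFirstBlock.exists_eq_Icc (hB i) (h i)
    obtain ⟨i₀, hi₀⟩ := Finite.exists_min q
    -- All first blocks start at 1, so the shortest is their intersection. The index `s` with value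
    -- `q i₀` stands for the variable numbered `q i₀ + 1`, which `u i₀` misses.
    have hinter : ⋂ i, (B i : Set ℕ) = Finset.Icc 1 (q i₀) := by
      ext x
      simp only [Set.mem_iInter, hBq, Finset.coe_Icc, Set.mem_Icc]
      exact ⟨fun hx => hx i₀, fun hx i => ⟨hx.1, hx.2.trans (hi₀ i)⟩⟩
    rw [hinter, Set.ncard_coe_finset, Nat.card_Icc, Nat.add_sub_cancel]
    refine analyticSpread_borelIdeal hu hd hmin hprincipal ?_ (fun s hs => ⟨i₀, ?_⟩) hhigh hhigh'
    · intro i j hj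
      refine hone i j (succ_mem_supp_iff.mp (hsub i ?_))
      rw [hBq, Finset.mem_Icc]
      have := hi₀ i
      omega
    · by_contra hsi
      have := succ_mem_supp_iff.mpr hsi
      rw [hs] at this
      exact hnot i₀ this
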